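/- All Hilbert spaces are finite-dimensional and complex; positive operators are positive semidefinite operators, written as matrices in $\mathbb{C}^{n\times n}$ with respect to a fixed orthonormal basis. The support $\operatorname{supp}(A)$ of $A$ is the orthogonal complement of $\ker A$. Real powers of positive operators are defined by the functional calculus, with $0^s=0$ for $s\neq 0$ (so negative powers are taken on the support). For $\alpha\in(1,\infty)$ and positive operators $A,B$ on the same space, the sandwiched quasi-relative entropy is $$\widetilde{Q}_\alpha(A\|B)=\begin{cases}\operatorname{Tr}\left\{\left(B^{\frac{1-\alpha}{2\alpha}}\,A\,B^{\frac{1-\alpha}{2\alpha}}\right)^{\alpha}\right\} & \text{if } \operatorname{supp}(A)\subseteq\operatorname{supp}(B),\\ \infty & \text{otherwise,}\end{cases}$$ an element of $[0,\infty]$, in which $0\cdot\infty=0$. **Theorem.** Let $\alpha>1$. 1. (Unitary invariance) For all positive operators $A,B$ and every unitary $U$ on the same space, $\widetilde{Q}_\alpha(UAU^\dagger\|UBU^\dagger)=\widetilde{Q}_\alpha(A\|B)$. 2. (Multiplicativity) For all positive operators $A_1,B_1$ on one space and $A_2,B_2$ on another, $\widetilde{Q}_\alpha(A_1\otimes A_2\|B_1\otimes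 B_2)=\widetilde{Q}_\alpha(A_1\|B_1)\,\widetilde{Q}_\alpha(A_2\|B_2)$. 3. (Invariance under tensoring with a state) For all positive operators $A,B$ on one space and every density operator $\tau$ on another (that is, $\tau$ is positive with $\operatorname{Tr}\tau=1$), $\widetilde{Q}_\alpha(A\otimes\tau\|B\otimes\tau)=\widetilde{Q}_\alpha(A\|B)$. 4. (Joint convexity) If moreover $\alpha\in(1,2]$, then for every probability distribution $p$ on a finite set and all families $(A_x)$, $(B_x)$ of positive operators on the same space, $$\sum_x p(x)\,\widetilde{Q}_\alpha(A_x\|B_x)\ \geq\ \widetilde{Q}_\alpha\Big(\sum_x p(x)A_x\,\Big\|\,\sum_x p(x)B_x\Big).$$ -/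

import Mathlib

open scoped MatrixOrder ComplexOrder Kronecker ENNReal Matrix

/-- The support of an operator on `ℂⁿ`: the orthogonal complement of its kernel. -/
noncomputable def opSupport {n : Type*} [Fintype n] [DecidableEq n] (A : Matrix n n ℂ) :
    Submodule ℂ (EuclideanSpace ℂ n) :=
  (LinearMap.ker (Matrix.toEuclideanLin A))ᗮ

/-- The operator `(B ^ ((1 - α) / (2α)) A B ^ ((1 - α) / (2α))) ^ α`. Powers of positive
semidefinite matrices are taken by functional calculus, where `0 ^ s = 0` for every real
`s ≠ 0`, so a negative power of `B` is a power of the inverse of `B` on its support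
and vanishes on the kernel of `B`. -/
noncomputable def sandwichedOp {n : Type*} [Fintype n] [DecidableEq n] (α : ℝ)
    (A B : Matrix n n ℂ) : Matrix n n ℂ :=
  (B ^ ((1 - α) / (2 * α)) * A * B ^ ((1 - α) / (2 * α))) ^ α

/-- The trace in the next definition is a nonnegative real number, so that passing to
`ℝ≥0∞` loses nothing. -/
theorem sandwichedOp_trace_nonneg {n : Type*} [Fintype n] [DecidableEq n] (α : ℝ)
    (A B : Matrix n n ℂ) : 0 ≤ (sandwichedOp α A B).trace :=
  (Matrix.nonneg_iff_posSemidef.mp CFC.rpow_nonneg).trace_nonneg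

open Classical in
/-- The sandwiched quasi-relative entropy of positive semidefinite `A` and `B`, for `α > 1`,
with values in `[0, ∞]`. -/
noncomputable def sandwichedQ {n : Type*} [Fintype n] [DecidableEq n] (α : ℝ)
    (A B : Matrix n n ℂ) : ℝ≥0∞ :=
  if opSupport A ≤ opSupport B then ENNReal.ofReal (sandwichedOp α A B).trace.re else ∞

/-! Joint convexity rests on a variational formula. With p = (α - 1)/α in (0, 1), and under the
support inclusion, Q(A‖B) is the maximum over K of α Tr(A K Kᴴ) - (α - 1) Tr (Kᴴ B^p K)^(1/p)
(`le_trace_sandwichedOp`, `exists_trace_sandwichedOp_eq`). The first term is linear in A, and the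
subtracted trace is concave in B (`sum_trace_conj_rpow_le`), so Q is a supremum of jointly convex
functions. The concavity in B follows by Young's trace inequality from Lieb's theorem. Lieb's
theorem holds because d^p e^(1-p) is an integral of parallel sums of d and t e, and a parallel sum
is a minimum of expressions linear in the pair.

Unitary invariance and multiplicativity hold because real powers respect conjugation and Kronecker
products. The infinite values are settled by `sandwichedQ_eq_zero_iff`, which controls 0 · ∞.
Tensoring with a state multiplies by Q(τ‖τ) = Tr τ = 1. -/

namespace Matrix

/-! ### Functional calculus through explicit diagonalizations -/

section UnitaryDiag

variable {n m : Type*} [Fintype n] [DecidableEq n] [Fintype m] [DecidableEq m]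

/-- The Hermitian matrix with real eigenvalues `d` and eigenvectors the columns of `U`. -/
noncomputable def unitaryDiag (U : Matrix n n ℂ) (d : n → ℝ) : Matrix n n ℂ :=
  U * diagonal (fun i => (d i : ℂ)) * Uᴴ

theorem PosSemidef.exists_unitaryDiag {A : Matrix n n ℂ} (hA : A.PosSemidef) :
    ∃ U ∈ unitaryGroup n ℂ, ∃ d : n → ℝ, (∀ i, 0 ≤ d i) ∧ A = unitaryDiag U d := by
  refine ⟨hA.isHermitian.eigenvectorUnitary, hA.isHermitian.eigenvectorUnitary.2,
    hA.isHermitian.eigenvalues, hA.eigenvalues_nonneg, ?_⟩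
  conv_lhs => rw [hA.isHermitian.spectral_theorem, Unitary.conjStarAlgAut_apply]
  rfl

theorem conjTranspose_mul_self_of_mem_unitaryGroup {U : Matrix n n ℂ}
    (hU : U ∈ unitaryGroup n ℂ) : Uᴴ * U = 1 :=
  mem_unitaryGroup_iff'.mp hU

theorem mul_conjTranspose_self_of_mem_unitaryGroup {U : Matrix n n ℂ}
    (hU : U ∈ unitaryGroup n ℂ) : U * Uᴴ = 1 :=
  mem_unitaryGroup_iff.mp hU

theorem unitaryDiag_mul_unitaryDiag {U : Matrix n n ℂ} (hU : U ∈ unitaryGroup n ℂ)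
    (d e : n → ℝ) : unitaryDiag U d * unitaryDiag U e = unitaryDiag U (fun i => d i * e i) := by
  have h := conjTranspose_mul_self_of_mem_unitaryGroup hU
  calc unitaryDiag U d * unitaryDiag U e
      = U * diagonal (fun i => (d i : ℂ)) * (Uᴴ * U) * diagonal (fun i => (e i : ℂ)) * Uᴴ := by
        simp only [unitaryDiag, Matrix.mul_assoc]
    _ = unitaryDiag U (fun i => d i * e i) := by
        rw [h, Matrix.mul_one, Matrix.mul_assoc U, diagonal_mul_diagonal]
        simp [unitaryDiag]

theorem unitaryDiag_const {U : Matrix n n ℂ} (hU : U ∈ unitaryGroup n ℂ) (c : ℝ) :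
    unitaryDiag U (fun _ => c) = algebraMap ℝ _ c := by
  have h := mul_conjTranspose_self_of_mem_unitaryGroup hU
  rw [unitaryDiag, ← smul_one_eq_diagonal, Matrix.mul_smul, Matrix.smul_mul, Matrix.mul_one, h,
    Algebra.algebraMap_eq_smul_one]
  ext i j
  simp

theorem unitaryDiag_add (U : Matrix n n ℂ) (d e : n → ℝ) :
    unitaryDiag U d + unitaryDiag U e = unitaryDiag U (fun i => d i + e i) := by
  simp only [unitaryDiag, Complex.ofReal_add]
  rw [← Matrix.add_mul, ← Matrix.mul_add, diagonal_add]

theorem unitaryDiag_isHermitian (U : Matrix n n ℂ) (d : n → ℝ) :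
    (unitaryDiag U d).IsHermitian := by
  refine isHermitian_mul_mul_conjTranspose U ?_
  rw [isHermitian_diagonal_iff]
  intro i
  simp [IsSelfAdjoint]

theorem unitaryDiag_posSemidef (U : Matrix n n ℂ) {d : n → ℝ} (hd : ∀ i, 0 ≤ d i) :
    (unitaryDiag U d).PosSemidef := by
  refine PosSemidef.mul_mul_conjTranspose_same (PosSemidef.diagonal fun i => ?_) U
  simpa using hd i

theorem unitaryDiag_pow {U : Matrix n n ℂ} (hU : U ∈ unitaryGroup n ℂ) (d : n → ℝ) (k : ℕ) :
    unitaryDiag U d ^ k = unitaryDiag U (fun i => d i ^ k) := by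
  induction k with
  | zero => simpa using (unitaryDiag_const hU 1).symm
  | succ k ih => rw [pow_succ, ih, unitaryDiag_mul_unitaryDiag hU]; simp [pow_succ]

theorem aeval_unitaryDiag {U : Matrix n n ℂ} (hU : U ∈ unitaryGroup n ℂ) (d : n → ℝ)
    (q : Polynomial ℝ) :
    Polynomial.aeval (unitaryDiag U d) q = unitaryDiag U (fun i => q.eval (d i)) := by
  induction q using Polynomial.induction_on' with
  | add p q hp hq => rw [map_add, hp, hq, unitaryDiag_add]; simp
  | monomial k a =>
    rw [Polynomial.aeval_monomial, unitaryDiag_pow hU, ← unitaryDiag_const hU,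
      unitaryDiag_mul_unitaryDiag hU]
    simp

theorem cfc_unitaryDiag {U : Matrix n n ℂ} (hU : U ∈ unitaryGroup n ℂ) (d : n → ℝ)
    (f : ℝ → ℝ) : cfc f (unitaryDiag U d) = unitaryDiag U (fun i => f (d i)) := by
  -- On a finite set any function is a polynomial. Interpolating on both the entries and the
  -- spectrum avoids having to identify the two.
  have hfin := (Set.finite_range d).union (finite_real_spectrum (A := unitaryDiag U d))
  set q : Polynomial ℝ := Lagrange.interpolate hfin.toFinset id f with hq
  have hqf : ∀ x ∈ Set.range d ∪ spectrum ℝ (unitaryDiag U d), f x = q.eval x := fun x hx =>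
    (Lagrange.eval_interpolate_at_node f (v := id) (Set.injOn_id _)
      (hfin.mem_toFinset.mpr hx)).symm
  have hsa : IsSelfAdjoint (unitaryDiag U d) := unitaryDiag_isHermitian U d
  rw [cfc_congr (g := fun x => q.eval x) (fun x hx => hqf x (Or.inr hx)),
    cfc_polynomial q _ hsa, aeval_unitaryDiag hU]
  congr 1
  ext i
  exact (hqf _ (Or.inl ⟨i, rfl⟩)).symm

theorem unitaryDiag_rpow {U : Matrix n n ℂ} (hU : U ∈ unitaryGroup n ℂ) {d : n → ℝ}
    (hd : ∀ i, 0 ≤ d i) (r : ℝ) :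
    (unitaryDiag U d) ^ r = unitaryDiag U (fun i => d i ^ r) := by
  have h0 : 0 ≤ unitaryDiag U d := nonneg_iff_posSemidef.mpr (unitaryDiag_posSemidef U hd)
  rw [CFC.rpow_def, cfc_nnreal_eq_real _ _ h0, cfc_unitaryDiag hU]
  congr 1
  ext i
  simp [Real.coe_toNNReal _ (hd i)]

theorem trace_unitaryDiag {U : Matrix n n ℂ} (hU : U ∈ unitaryGroup n ℂ) (d : n → ℝ) :
    (unitaryDiag U d).trace = ((∑ i, d i : ℝ) : ℂ) := by
  rw [unitaryDiag, trace_mul_comm, ← Matrix.mul_assoc,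
    conjTranspose_mul_self_of_mem_unitaryGroup hU, Matrix.one_mul]
  simp [trace]

theorem mul_unitaryDiag_mul_conjTranspose (U V : Matrix n n ℂ) (d : n → ℝ) :
    U * unitaryDiag V d * Uᴴ = unitaryDiag (U * V) d := by
  simp only [unitaryDiag, conjTranspose_mul, Matrix.mul_assoc]

theorem unitaryDiag_kronecker (U : Matrix n n ℂ) (V : Matrix m m ℂ) (d : n → ℝ) (e : m → ℝ) :
    unitaryDiag U d ⊗ₖ unitaryDiag V e = unitaryDiag (U ⊗ₖ V) (fun i => d i.1 * e i.2) := by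
  simp only [unitaryDiag, conjTranspose_kronecker, mul_kronecker_mul, diagonal_kronecker_diagonal,
    Complex.ofReal_mul]

/-- Left multiplication by one Hermitian matrix and right multiplication by another are
simultaneously diagonal in the two eigenbases, so trace inequalities reduce to scalar ones with
nonnegative weights. -/
theorem trace_unitaryDiag_mul_mul (U V K : Matrix n n ℂ) (d e : n → ℝ) :
    (unitaryDiag U d * K * unitaryDiag V e * Kᴴ).trace =
      ((∑ i, ∑ j, d i * e j * Complex.normSq ((Uᴴ * K * V) i j) : ℝ) : ℂ) := by
  have h : (unitaryDiag U d * K * unitaryDiag V e * Kᴴ).trace =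
      (diagonal (fun i => (d i : ℂ)) * (Uᴴ * K * V) * diagonal (fun i => (e i : ℂ)) *
        (Uᴴ * K * V)ᴴ).trace := by
    simp only [unitaryDiag, conjTranspose_mul, conjTranspose_conjTranspose]
    simp only [Matrix.mul_assoc]
    rw [trace_mul_comm]
    simp only [Matrix.mul_assoc]
  rw [h]
  simp only [trace, diag_apply, mul_apply (N := (Uᴴ * K * V)ᴴ), mul_diagonal, diagonal_mul,
    conjTranspose_apply, Complex.ofReal_sum, Complex.ofReal_mul]
  refine Finset.sum_congr rfl fun i _ => Finset.sum_congr rfl fun j _ => ?_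
  rw [Complex.normSq_eq_conj_mul_self, ← Complex.star_def]
  ring

theorem sum_normSq_row {U : Matrix n n ℂ} (hU : U ∈ unitaryGroup n ℂ) (i : n) :
    ∑ j, Complex.normSq (U i j) = 1 := by
  have h := congrFun₂ (mul_conjTranspose_self_of_mem_unitaryGroup hU) i i
  rw [mul_apply] at h
  have : ((∑ j, Complex.normSq (U i j) : ℝ) : ℂ) = 1 := by
    rw [← one_apply_eq i, ← h]
    push_cast
    exact Finset.sum_congr rfl fun j _ => by
      rw [conjTranspose_apply, Complex.star_def, Complex.mul_conj]
  exact_mod_cast this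

theorem sum_normSq_col {U : Matrix n n ℂ} (hU : U ∈ unitaryGroup n ℂ) (j : n) :
    ∑ i, Complex.normSq (U i j) = 1 := by
  have h := sum_normSq_row (Unitary.star_mem hU) j
  simpa [star_eq_conjTranspose] using h

end UnitaryDiag

/-! ### Real powers of positive semidefinite matrices and Young's trace inequality -/

section Rpow

variable {n m : Type*} [Fintype n] [DecidableEq n] [Fintype m] [DecidableEq m]

theorem rpow_posSemidef (A : Matrix n n ℂ) (r : ℝ) : (A ^ r).PosSemidef :=
  nonneg_iff_posSemidef.mp CFC.rpow_nonneg

/-- The excluded case is that of opposite nonzero exponents: on the kernel the product is 0, whereas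
the zeroth power is 1. -/
theorem PosSemidef.rpow_mul_rpow {A : Matrix n n ℂ} (hA : A.PosSemidef) {r s : ℝ}
    (h : r + s ≠ 0 ∨ r = 0) : A ^ r * A ^ s = A ^ (r + s) := by
  obtain ⟨U, hU, d, hd, rfl⟩ := hA.exists_unitaryDiag
  simp only [unitaryDiag_rpow hU hd, unitaryDiag_mul_unitaryDiag hU]
  congr 1
  ext i
  rcases h with h | rfl
  · exact (Real.rpow_add' (hd i) h).symm
  · simp

theorem PosSemidef.rpow_rpow {A : Matrix n n ℂ} (hA : A.PosSemidef) (r s : ℝ) :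
    (A ^ r) ^ s = A ^ (r * s) := by
  obtain ⟨U, hU, d, hd, rfl⟩ := hA.exists_unitaryDiag
  rw [unitaryDiag_rpow hU hd, unitaryDiag_rpow hU fun i => Real.rpow_nonneg (hd i) r,
    unitaryDiag_rpow hU hd]
  congr 1
  ext i
  exact (Real.rpow_mul (hd i) r s).symm

theorem PosSemidef.rpow_one' {A : Matrix n n ℂ} (hA : A.PosSemidef) : A ^ (1 : ℝ) = A :=
  CFC.rpow_one A (nonneg_iff_posSemidef.mpr hA)

theorem PosSemidef.conj_rpow {A U : Matrix n n ℂ} (hA : A.PosSemidef)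
    (hU : U ∈ unitaryGroup n ℂ) (r : ℝ) : (U * A * Uᴴ) ^ r = U * A ^ r * Uᴴ := by
  obtain ⟨V, hV, d, hd, rfl⟩ := hA.exists_unitaryDiag
  rw [unitaryDiag_rpow hV hd, mul_unitaryDiag_mul_conjTranspose,
    mul_unitaryDiag_mul_conjTranspose, unitaryDiag_rpow (mul_mem hU hV) hd]

theorem PosSemidef.kronecker_rpow {A : Matrix n n ℂ} {B : Matrix m m ℂ} (hA : A.PosSemidef)
    (hB : B.PosSemidef) (r : ℝ) : (A ⊗ₖ B) ^ r = (A ^ r) ⊗ₖ (B ^ r) := by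
  obtain ⟨U, hU, d, hd, rfl⟩ := hA.exists_unitaryDiag
  obtain ⟨V, hV, e, he, rfl⟩ := hB.exists_unitaryDiag
  rw [unitaryDiag_rpow hU hd, unitaryDiag_rpow hV he, unitaryDiag_kronecker,
    unitaryDiag_kronecker, unitaryDiag_rpow (kronecker_mem_unitary hU hV)
      fun i => mul_nonneg (hd _) (he _)]
  congr 1
  ext i
  exact Real.mul_rpow (hd _) (he _)

/-- Only the characteristic polynomial enters the right side, so M Mᴴ and Mᴴ M have equal traces of
powers. -/
theorem PosSemidef.trace_rpow {A : Matrix n n ℂ} (hA : A.PosSemidef) (r : ℝ) :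
    (A ^ r).trace = (A.charpoly.roots.map fun z => ((z.re ^ r : ℝ) : ℂ)).sum := by
  obtain ⟨U, hU, d, hd, rfl⟩ := hA.exists_unitaryDiag
  have hc : (unitaryDiag U d).charpoly = (diagonal fun i => (d i : ℂ)).charpoly := by
    rw [unitaryDiag, charpoly_mul_comm, ← Matrix.mul_assoc,
      conjTranspose_mul_self_of_mem_unitaryGroup hU, Matrix.one_mul]
  rw [unitaryDiag_rpow hU hd, trace_unitaryDiag hU, hc, charpoly_diagonal, Polynomial.roots_prod]
  · simp
  · exact Finset.prod_ne_zero_iff.mpr fun i _ => Polynomial.X_sub_C_ne_zero _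

theorem trace_rpow_mul_conjTranspose_comm (M : Matrix n n ℂ) (r : ℝ) :
    ((M * Mᴴ) ^ r).trace = ((Mᴴ * M) ^ r).trace := by
  rw [(posSemidef_self_mul_conjTranspose M).trace_rpow,
    (posSemidef_conjTranspose_mul_self M).trace_rpow, charpoly_mul_comm]

theorem PosSemidef.eq_zero_of_trace_rpow_eq_zero {A : Matrix n n ℂ} (hA : A.PosSemidef) {r : ℝ}
    (hr : r ≠ 0) (h : (A ^ r).trace = 0) : A = 0 := by
  have h0 := (rpow_posSemidef A r).trace_eq_zero_iff.mp h
  have h1 : (A ^ r) ^ r⁻¹ = A := by rw [hA.rpow_rpow, mul_inv_cancel₀ hr, hA.rpow_one']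
  rw [← h1, h0]
  exact CFC.zero_rpow (inv_ne_zero hr)

/-- Young's inequality for the trace of a product of positive semidefinite matrices. -/
theorem PosSemidef.trace_mul_le_young {Z Y : Matrix n n ℂ} (hZ : Z.PosSemidef)
    (hY : Y.PosSemidef) {p : ℝ} (hp0 : 0 < p) (hp1 : p < 1) :
    (Z * Y).trace.re ≤
      p * (Z ^ (1 / p)).trace.re + (1 - p) * (Y ^ (1 / (1 - p))).trace.re := by
  obtain ⟨U, hU, d, hd, rfl⟩ := hZ.exists_unitaryDiag
  obtain ⟨V, hV, e, he, rfl⟩ := hY.exists_unitaryDiag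
  have hW : Uᴴ * V ∈ unitaryGroup n ℂ := mul_mem (Unitary.star_mem hU) hV
  have key := trace_unitaryDiag_mul_mul U V 1 d e
  rw [conjTranspose_one, Matrix.mul_one, Matrix.mul_one, Matrix.mul_one] at key
  rw [key, unitaryDiag_rpow hU hd, unitaryDiag_rpow hV he, trace_unitaryDiag hU,
    trace_unitaryDiag hV, Complex.ofReal_re, Complex.ofReal_re, Complex.ofReal_re]
  -- These weights are doubly stochastic, so each single sum becomes a double sum and scalar Young
  -- applies termwise.
  set w : n → n → ℝ := fun i j => Complex.normSq ((Uᴴ * V) i j)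
  have hq : (0 : ℝ) < 1 - p := by linarith
  have hpq : (1 / p).HolderConjugate (1 / (1 - p)) := by
    rw [Real.holderConjugate_iff]
    refine ⟨by rw [lt_div_iff₀ hp0]; linarith, by simp⟩
  have h1 : ∑ i, d i ^ (1 / p) = ∑ i, ∑ j, d i ^ (1 / p) * w i j := by
    refine Finset.sum_congr rfl fun i _ => ?_
    rw [← Finset.mul_sum, sum_normSq_row hW, mul_one]
  have h2 : ∑ j, e j ^ (1 / (1 - p)) = ∑ i, ∑ j, e j ^ (1 / (1 - p)) * w i j := by
    rw [Finset.sum_comm]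
    refine Finset.sum_congr rfl fun i _ => ?_
    rw [← Finset.mul_sum, sum_normSq_col hW, mul_one]
  rw [h1, h2, Finset.mul_sum, Finset.mul_sum, ← Finset.sum_add_distrib]
  refine Finset.sum_le_sum fun i _ => ?_
  rw [Finset.mul_sum, Finset.mul_sum, ← Finset.sum_add_distrib]
  refine Finset.sum_le_sum fun j _ => ?_
  have hy := Real.young_inequality_of_nonneg (hd i) (he j) hpq
  have hw : 0 ≤ w i j := Complex.normSq_nonneg _
  calc d i * e j * w i j
      ≤ (d i ^ (1 / p) / (1 / p) + e j ^ (1 / (1 - p)) / (1 / (1 - p))) * w i j :=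
        mul_le_mul_of_nonneg_right hy hw
    _ = _ := by field_simp

end Rpow

end Matrix

/-! ### Scalar facts about parallel sums and the integrand for x^p -/

section Scalar

open Real Set MeasureTheory

/-- The integrand is t^(p-1) x/(t + x); at x = d/e, scaling by e yields t^(p-2) times the parallel
sum of d and t e. -/
theorem mul_rpowIntegrand₀₁_div {p t d e : ℝ} (hp : p ∈ Ioo 0 1) (ht : 0 < t) (hd : 0 ≤ d)
    (he : 0 ≤ e) : e * rpowIntegrand₀₁ p t (d / e) = t ^ (p - 1) * (d * e / (d + t * e)) := by
  rcases he.eq_or_lt with rfl | he'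
  · simp
  · rw [rpowIntegrand₀₁_eq_pow_div hp ht.le (by positivity)]
    have : 0 < d + t * e := by positivity
    have : 0 < t + d / e := by positivity
    field_simp
    ring

theorem rpow_mul_rpow_one_sub {p d e : ℝ} (hp : p ∈ Ioo 0 1) (hd : 0 ≤ d) (he : 0 ≤ e) :
    e * (d / e) ^ p = d ^ p * e ^ (1 - p) := by
  rcases he.eq_or_lt with rfl | he'
  · simp [zero_rpow (sub_pos.mpr hp.2).ne']
  · rw [div_rpow hd he, rpow_sub he', rpow_one]
    ring

/-- After clearing the denominator, the difference of the two sides is |d a - e b|². -/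
theorem mul_normSq_add_le {d e : ℝ} (hd : 0 ≤ d) (he : 0 ≤ e) (a b : ℂ) :
    d * e / (d + e) * Complex.normSq (a + b) ≤
      d * Complex.normSq a + e * Complex.normSq b := by
  rcases (add_nonneg hd he).eq_or_lt with h | h
  · rw [← h]
    have := Complex.normSq_nonneg a
    have := Complex.normSq_nonneg b
    simp only [div_zero, zero_mul]
    positivity
  · rw [div_mul_eq_mul_div, div_le_iff₀ h]
    simp only [Complex.normSq_apply, Complex.add_re, Complex.add_im]
    nlinarith [sq_nonneg (d * a.re - e * b.re), sq_nonneg (d * a.im - e * b.im)]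

/-- Equality case of `mul_normSq_add_le`: the splitting of z is chosen so that d a = e b. -/
theorem mul_normSq_weights {d e : ℝ} (hd : 0 ≤ d) (he : 0 ≤ e) (z : ℂ) :
    d * Complex.normSq (((e / (d + e) : ℝ) : ℂ) * z) +
      e * Complex.normSq (z - ((e / (d + e) : ℝ) : ℂ) * z) =
      d * e / (d + e) * Complex.normSq z := by
  have h1 : z - ((e / (d + e) : ℝ) : ℂ) * z = ((1 - e / (d + e) : ℝ) : ℂ) * z := by
    push_cast
    ring
  rw [h1, Complex.normSq_mul, Complex.normSq_mul, Complex.normSq_ofReal, Complex.normSq_ofReal]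
  rcases (add_nonneg hd he).eq_or_lt with h | h
  · obtain ⟨rfl, rfl⟩ := (add_eq_zero_iff_of_nonneg hd he).mp h.symm
    simp
  · field_simp
    ring

end Scalar

namespace Matrix

/-! ### Lieb's concavity theorem -/

section Lieb

variable {n : Type*} [Fintype n] [DecidableEq n]

theorem trace_unitaryDiag_mul_conjTranspose {U V : Matrix n n ℂ} (hV : V ∈ unitaryGroup n ℂ)
    (R : Matrix n n ℂ) (d : n → ℝ) :
    (unitaryDiag U d * R * Rᴴ).trace.re =
      ∑ i, ∑ j, d i * Complex.normSq ((Uᴴ * R * V) i j) := by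
  have h := trace_unitaryDiag_mul_mul U V R d (fun _ => 1)
  rw [unitaryDiag_const hV, map_one, Matrix.mul_one] at h
  rw [h, Complex.ofReal_re]
  simp

theorem trace_mul_unitaryDiag_mul_conjTranspose {U V : Matrix n n ℂ} (hU : U ∈ unitaryGroup n ℂ)
    (S : Matrix n n ℂ) (e : n → ℝ) :
    (S * unitaryDiag V e * Sᴴ).trace.re =
      ∑ i, ∑ j, e j * Complex.normSq ((Uᴴ * S * V) i j) := by
  have h := trace_unitaryDiag_mul_mul U V S (fun _ => 1) e
  rw [unitaryDiag_const hU, map_one, Matrix.one_mul] at h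
  rw [h, Complex.ofReal_re]
  simp

/-- The quadratic form at `K` of the parallel sum of left multiplication by `unitaryDiag U d` and
right multiplication by `unitaryDiag V e`. -/
noncomputable def parallelForm (U V K : Matrix n n ℂ) (d e : n → ℝ) : ℝ :=
  ∑ i, ∑ j, d i * e j / (d i + e j) * Complex.normSq ((Uᴴ * K * V) i j)

/-- With `exists_parallelForm_eq`, this makes the form a minimum, over splittings K = R + S, of
expressions linear in the two matrices. -/
theorem parallelForm_add_le {U V : Matrix n n ℂ} (hU : U ∈ unitaryGroup n ℂ)
    (hV : V ∈ unitaryGroup n ℂ) {d e : n → ℝ} (hd : ∀ i, 0 ≤ d i) (he : ∀ i, 0 ≤ e i)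
    (R S : Matrix n n ℂ) :
    parallelForm U V (R + S) d e ≤
      (unitaryDiag U d * R * Rᴴ).trace.re + (S * unitaryDiag V e * Sᴴ).trace.re := by
  rw [trace_unitaryDiag_mul_conjTranspose hV, trace_mul_unitaryDiag_mul_conjTranspose hU,
    ← Finset.sum_add_distrib]
  refine Finset.sum_le_sum fun i _ => ?_
  rw [← Finset.sum_add_distrib]
  refine Finset.sum_le_sum fun j _ => ?_
  rw [Matrix.mul_add, Matrix.add_mul, add_apply]
  exact mul_normSq_add_le (hd i) (he j) _ _

theorem exists_parallelForm_eq {U V : Matrix n n ℂ} (hU : U ∈ unitaryGroup n ℂ)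
    (hV : V ∈ unitaryGroup n ℂ) {d e : n → ℝ} (hd : ∀ i, 0 ≤ d i) (he : ∀ i, 0 ≤ e i)
    (K : Matrix n n ℂ) :
    ∃ R S, R + S = K ∧ parallelForm U V K d e =
      (unitaryDiag U d * R * Rᴴ).trace.re + (S * unitaryDiag V e * Sᴴ).trace.re := by
  -- The optimal scalar splitting, entry by entry in the two eigenbases.
  set N : Matrix n n ℂ :=
    of fun i j => ((e j / (d i + e j) : ℝ) : ℂ) * (Uᴴ * K * V) i j with hN
  have hR : Uᴴ * (U * N * Vᴴ) * V = N := by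
    calc Uᴴ * (U * N * Vᴴ) * V = (Uᴴ * U) * N * (Vᴴ * V) := by simp only [Matrix.mul_assoc]
      _ = N := by
        rw [conjTranspose_mul_self_of_mem_unitaryGroup hU,
          conjTranspose_mul_self_of_mem_unitaryGroup hV, Matrix.one_mul, Matrix.mul_one]
  refine ⟨U * N * Vᴴ, K - U * N * Vᴴ, by abel, ?_⟩
  rw [trace_unitaryDiag_mul_conjTranspose hV, trace_mul_unitaryDiag_mul_conjTranspose hU,
    ← Finset.sum_add_distrib, parallelForm]
  refine Finset.sum_congr rfl fun i _ => ?_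
  rw [← Finset.sum_add_distrib]
  refine Finset.sum_congr rfl fun j _ => ?_
  rw [Matrix.mul_sub, Matrix.sub_mul, hR, sub_apply, hN, of_apply]
  exact (mul_normSq_weights (hd i) (he j) _).symm

/-- The splitting of K that is optimal for the averaged pair is a competitor for every individual
pair. -/
theorem sum_parallelForm_le {ι : Type*} [Fintype ι] {w : ι → ℝ} (hw : ∀ x, 0 ≤ w x)
    {U V : ι → Matrix n n ℂ} (hU : ∀ x, U x ∈ unitaryGroup n ℂ)
    (hV : ∀ x, V x ∈ unitaryGroup n ℂ) {d e : ι → n → ℝ} (hd : ∀ x i, 0 ≤ d x i)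
    (he : ∀ x i, 0 ≤ e x i) {U₀ V₀ : Matrix n n ℂ} (hU₀ : U₀ ∈ unitaryGroup n ℂ)
    (hV₀ : V₀ ∈ unitaryGroup n ℂ) {d₀ e₀ : n → ℝ} (hd₀ : ∀ i, 0 ≤ d₀ i) (he₀ : ∀ i, 0 ≤ e₀ i)
    (hB : ∑ x, w x • unitaryDiag (U x) (d x) = unitaryDiag U₀ d₀)
    (hX : ∑ x, w x • unitaryDiag (V x) (e x) = unitaryDiag V₀ e₀) (K : Matrix n n ℂ) :
    ∑ x, w x * parallelForm (U x) (V x) K (d x) (e x) ≤ parallelForm U₀ V₀ K d₀ e₀ := by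
  obtain ⟨R, S, rfl, hRS⟩ := exists_parallelForm_eq hU₀ hV₀ hd₀ he₀ K
  rw [hRS, ← hB, ← hX]
  simp only [Matrix.sum_mul, Matrix.mul_sum, Matrix.smul_mul, Matrix.mul_smul, trace_sum,
    trace_smul, Complex.re_sum, Complex.smul_re, smul_eq_mul]
  rw [← Finset.sum_add_distrib]
  refine Finset.sum_le_sum fun x _ => ?_
  rw [← mul_add]
  exact mul_le_mul_of_nonneg_left (parallelForm_add_le (hU x) (hV x) (hd x) (he x) R S) (hw x)

open Real Set MeasureTheory in
theorem trace_unitaryDiag_rpow_eq_integral {p : ℝ} (hp : p ∈ Ioo 0 1) (U V K : Matrix n n ℂ)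
    {d e : n → ℝ} (hd : ∀ i, 0 ≤ d i) (he : ∀ i, 0 ≤ e i) :
    IntegrableOn (fun t => t ^ (p - 2) * parallelForm U V K d (fun j => t * e j)) (Ioi 0) ∧
    (unitaryDiag U (fun i => d i ^ p) * K * unitaryDiag V (fun j => e j ^ (1 - p)) * Kᴴ).trace.re =
      (∫ t in Ioi 0, rpowIntegrand₀₁ p t 1)⁻¹ *
        ∫ t in Ioi 0, t ^ (p - 2) * parallelForm U V K d (fun j => t * e j) := by
  have hde : ∀ i j, 0 ≤ d i / e j := fun i j => div_nonneg (hd i) (he j)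
  set c : n → n → ℝ := fun i j => Complex.normSq ((Uᴴ * K * V) i j)
  have hI : ∀ i j, IntegrableOn (fun t => c i j * e j * rpowIntegrand₀₁ p t (d i / e j)) (Ioi 0) :=
    fun i j => (integrableOn_rpowIntegrand₀₁_Ioi hp (hde i j)).const_mul _
  have heq : EqOn (fun t => ∑ i, ∑ j, c i j * e j * rpowIntegrand₀₁ p t (d i / e j))
      (fun t => t ^ (p - 2) * parallelForm U V K d (fun j => t * e j)) (Ioi 0) := by
    intro t ht
    have ht : 0 < t := ht
    simp only [parallelForm, Finset.mul_sum]
    refine Finset.sum_congr rfl fun i _ => Finset.sum_congr rfl fun j _ => ?_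
    rw [mul_assoc, mul_rpowIntegrand₀₁_div hp ht (hd i) (he j),
      show p - 1 = p - 2 + 1 by ring, rpow_add_one ht.ne']
    ring
  have hsum : IntegrableOn (fun t => ∑ i, ∑ j, c i j * e j * rpowIntegrand₀₁ p t (d i / e j))
      (Ioi 0) :=
    integrable_finsetSum _ fun i _ => integrable_finsetSum _ fun j _ => hI i j
  refine ⟨hsum.congr_fun heq measurableSet_Ioi, ?_⟩
  rw [← setIntegral_congr_fun measurableSet_Ioi heq,
    integral_finsetSum _ fun i _ => integrable_finsetSum _ fun j _ => hI i j,
    trace_unitaryDiag_mul_mul, Complex.ofReal_re, Finset.mul_sum]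
  refine Finset.sum_congr rfl fun i _ => ?_
  rw [integral_finsetSum _ fun j _ => hI i j, Finset.mul_sum]
  refine Finset.sum_congr rfl fun j _ => ?_
  rw [integral_const_mul, ← rpow_mul_rpow_one_sub hp (hd i) (he j),
    rpow_eq_const_mul_integral hp (hde i j)]
  ring

open Real Set MeasureTheory in
/-- **Lieb's concavity theorem**. -/
theorem sum_trace_rpow_mul_rpow_le {ι : Type*} [Fintype ι] {w : ι → ℝ} (hw : ∀ x, 0 ≤ w x)
    {B X : ι → Matrix n n ℂ} (hB : ∀ x, (B x).PosSemidef) (hX : ∀ x, (X x).PosSemidef)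
    (K : Matrix n n ℂ) {p : ℝ} (hp : p ∈ Ioo 0 1) :
    ∑ x, w x * (B x ^ p * K * X x ^ (1 - p) * Kᴴ).trace.re ≤
      ((∑ x, w x • B x) ^ p * K * (∑ x, w x • X x) ^ (1 - p) * Kᴴ).trace.re := by
  have hB₀ : (∑ x, w x • B x).PosSemidef := posSemidef_sum _ fun x _ => (hB x).smul (hw x)
  have hX₀ : (∑ x, w x • X x).PosSemidef := posSemidef_sum _ fun x _ => (hX x).smul (hw x)
  choose U hU d hd hBd using fun x => (hB x).exists_unitaryDiag
  choose V hV e he hXe using fun x => (hX x).exists_unitaryDiag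
  obtain ⟨U₀, hU₀, d₀, hd₀, hBd₀⟩ := hB₀.exists_unitaryDiag
  obtain ⟨V₀, hV₀, e₀, he₀, hXe₀⟩ := hX₀.exists_unitaryDiag
  rw [hBd₀, hXe₀]
  simp only [hBd, hXe] at hBd₀ hXe₀ ⊢
  have h := fun x => trace_unitaryDiag_rpow_eq_integral hp (U x) (V x) K (hd x) (he x)
  have h₀ := trace_unitaryDiag_rpow_eq_integral hp U₀ V₀ K hd₀ he₀
  simp only [unitaryDiag_rpow (hU _) (hd _), unitaryDiag_rpow (hV _) (he _),
    unitaryDiag_rpow hU₀ hd₀, unitaryDiag_rpow hV₀ he₀]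
  simp only [(h _).2, h₀.2, mul_left_comm (w _)]
  rw [← Finset.mul_sum]
  refine mul_le_mul_of_nonneg_left ?_
    (inv_nonneg.mpr (integral_rpowIntegrand₀₁_one_pos hp).le)
  simp only [← integral_const_mul]
  rw [← integral_finsetSum _ fun x _ => (h x).1.const_mul (w x)]
  -- It suffices to compare integrands at each t, where the parallel form of B and t X is jointly
  -- concave.
  refine setIntegral_mono_on (integrable_finsetSum _ fun x _ => (h x).1.const_mul (w x)) h₀.1
    measurableSet_Ioi fun t ht => ?_
  have ht : 0 < t := ht
  simp only [mul_left_comm (w _)]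
  rw [← Finset.mul_sum]
  refine mul_le_mul_of_nonneg_left ?_ (rpow_nonneg ht.le _)
  have hsc : ∀ (W : Matrix n n ℂ) (f : n → ℝ),
      unitaryDiag W (fun j => t * f j) = t • unitaryDiag W f := fun W f => by
    ext i j
    simp [unitaryDiag, mul_apply, Finset.mul_sum, diagonal_apply]
    exact Finset.sum_congr rfl fun _ _ => by ring
  refine sum_parallelForm_le hw hU hV hd (fun x i => mul_nonneg ht.le (he x i)) hU₀ hV₀ hd₀
    (fun i => mul_nonneg ht.le (he₀ i)) hBd₀ ?_ K
  simp only [hsc]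
  rw [← hXe₀, Finset.smul_sum]
  exact Finset.sum_congr rfl fun x _ => smul_comm _ _ _

end Lieb

theorem kronecker_mulVec_mul {n m : Type*} [Fintype n] [Fintype m]
    (M : Matrix n n ℂ) (N : Matrix m m ℂ) (v : n → ℂ) (u : m → ℂ) (i : n) (j : m) :
    ((M ⊗ₖ N) *ᵥ fun k => v k.1 * u k.2) (i, j) = (M *ᵥ v) i * (N *ᵥ u) j := by
  simp only [mulVec, dotProduct, kronecker_apply, Fintype.sum_prod_type, Finset.sum_mul_sum]
  exact Finset.sum_congr rfl fun _ _ => Finset.sum_congr rfl fun _ _ => by ring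

theorem exists_mulVec_apply_ne_zero {n : Type*} [Fintype n]
    {M : Matrix n n ℂ} (hM : M ≠ 0) : ∃ v i, (M *ᵥ v) i ≠ 0 := by
  by_contra! h
  exact hM (ext_iff_mulVec.mpr fun v => by ext i; simp [h v i])

/-! ### Epstein's concavity, deduced from Lieb's theorem -/

section Sandwiched

variable {n m : Type*} [Fintype n] [DecidableEq n] [Fintype m] [DecidableEq m]

theorem rpow_isHermitian (A : Matrix n n ℂ) (r : ℝ) : (A ^ r)ᴴ = A ^ r :=
  (rpow_posSemidef A r).isHermitian

theorem PosSemidef.self_mul_rpow {A : Matrix n n ℂ} (hA : A.PosSemidef) {r : ℝ}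
    (h : 1 + r ≠ 0) : A * A ^ r = A ^ (1 + r) := by
  conv_lhs => enter [1]; rw [← hA.rpow_one']
  exact hA.rpow_mul_rpow (Or.inl h)

/-- Concavity of `B ↦ Tr (Kᴴ B ^ p K) ^ (1 / p)` for `0 < p < 1`, due to Epstein. -/
theorem sum_trace_conj_rpow_le {ι : Type*} [Fintype ι] {w : ι → ℝ} (hw : ∀ x, 0 ≤ w x)
    {B : ι → Matrix n n ℂ} (hB : ∀ x, (B x).PosSemidef) (K : Matrix n n ℂ) {p : ℝ}
    (hp0 : 0 < p) (hp1 : p < 1) :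
    ∑ x, w x * ((Kᴴ * B x ^ p * K) ^ (1 / p)).trace.re ≤
      ((Kᴴ * (∑ x, w x • B x) ^ p * K) ^ (1 / p)).trace.re := by
  have hq : 0 < 1 - p := by linarith
  have hZ : ∀ B : Matrix n n ℂ, (Kᴴ * B ^ p * K).PosSemidef := fun B =>
    (rpow_posSemidef B p).conjTranspose_mul_mul_same K
  -- The choice giving equality in Young: with Z = Kᴴ B^p K and X = Z^(1/p), Z X^(1-p) = X.
  set X : ι → Matrix n n ℂ := fun x => (Kᴴ * B x ^ p * K) ^ (1 / p) with hXdef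
  have hX : ∀ x, (X x).PosSemidef := fun x => rpow_posSemidef _ _
  have hX₀ : (∑ x, w x • X x).PosSemidef := posSemidef_sum _ fun x _ => (hX x).smul (hw x)
  have hcyc : ∀ B Y : Matrix n n ℂ,
      (B ^ p * K * Y * Kᴴ).trace = ((Kᴴ * B ^ p * K) * Y).trace := fun B Y => by
    rw [trace_mul_comm]
    simp only [Matrix.mul_assoc]
  have h1 := sum_trace_rpow_mul_rpow_le hw hB hX K ⟨hp0, hp1⟩
  have h2 : ∀ x, (B x ^ p * K * X x ^ (1 - p) * Kᴴ).trace = (X x).trace := fun x => by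
    have he : 1 + 1 / p * (1 - p) = 1 / p := by field_simp; ring
    have hne : 1 + 1 / p * (1 - p) ≠ 0 := by rw [he]; positivity
    rw [hcyc, hXdef]
    simp only
    rw [(hZ (B x)).rpow_rpow, (hZ (B x)).self_mul_rpow hne, he]
  -- Young bounds the averaged side of Lieb's inequality. Its term (1 - p) Tr ∑ w X is absorbed on
  -- the left, leaving a common factor p.
  have h3 := (hZ (∑ x, w x • B x)).trace_mul_le_young (rpow_posSemidef (∑ x, w x • X x) (1 - p))
    hp0 hp1
  rw [hX₀.rpow_rpow, mul_one_div_cancel hq.ne', hX₀.rpow_one'] at h3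
  rw [hcyc] at h1
  simp only [h2] at h1
  have h4 : (∑ x, w x • X x).trace.re = ∑ x, w x * (X x).trace.re := by
    simp [trace_sum, Complex.re_sum]
  rw [h4] at h3
  refine le_of_mul_le_mul_left ?_ hp0
  linarith

/-- Opposite powers multiply to the projection onto the support, represented throughout by `B * B ^
(-1 : ℝ)`. -/
theorem PosSemidef.rpow_mul_rpow_neg {B : Matrix n n ℂ} (hB : B.PosSemidef) {r : ℝ}
    (hr : r ≠ 0) : B ^ r * B ^ (-r) = B * B ^ (-1 : ℝ) := by
  conv_rhs => enter [1]; rw [← hB.rpow_one']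
  obtain ⟨U, hU, d, hd, rfl⟩ := hB.exists_unitaryDiag
  simp only [unitaryDiag_rpow hU hd, unitaryDiag_mul_unitaryDiag hU]
  congr 1
  ext i
  rcases (hd i).eq_or_lt with h | h
  · simp [← h, Real.zero_rpow hr]
  · rw [← Real.rpow_add h, ← Real.rpow_add h, add_neg_cancel, add_neg_cancel]

theorem PosSemidef.mul_rpow_neg_one_mul_rpow {B : Matrix n n ℂ} (hB : B.PosSemidef) {r : ℝ}
    (hr : r ≠ 0) : B * B ^ (-1 : ℝ) * B ^ r = B ^ r := by
  obtain ⟨U, hU, d, hd, rfl⟩ := hB.exists_unitaryDiag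
  simp only [unitaryDiag_rpow hU hd, unitaryDiag_mul_unitaryDiag hU]
  congr 1
  ext i
  rcases (hd i).eq_or_lt with h | h
  · simp [← h, Real.zero_rpow hr]
  · rw [Real.rpow_neg_one, mul_inv_cancel₀ h.ne', one_mul]

theorem opSupport_le_iff_mulVec {A B : Matrix n n ℂ} :
    opSupport A ≤ opSupport B ↔ ∀ v, B *ᵥ v = 0 → A *ᵥ v = 0 := by
  rw [opSupport, opSupport, Submodule.orthogonal_le_orthogonal_iff]
  constructor
  · intro h v hv
    have := @h (WithLp.toLp 2 v) (by simp [hv])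
    simpa [toLpLin_toLp] using this
  · intro h v hv
    have := h v.ofLp (by simpa [toLpLin_apply] using hv)
    simp [toLpLin_apply, this]

/-- With P the support projection of B, inclusion says that A kills ker B, the range of 1 - P. This
equation transports easily through conjugation and Kronecker products. -/
theorem PosSemidef.opSupport_le_iff {A B : Matrix n n ℂ} (hB : B.PosSemidef) :
    opSupport A ≤ opSupport B ↔ A * (B * B ^ (-1 : ℝ)) = A := by
  have hcomm : B ^ (-1 : ℝ) * B = B * B ^ (-1 : ℝ) := by
    have := hB.rpow_mul_rpow_neg (r := -1) (by norm_num)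
    rwa [neg_neg, hB.rpow_one'] at this
  rw [opSupport_le_iff_mulVec]
  constructor
  · intro h
    have h0 : B * (1 - B * B ^ (-1 : ℝ)) = 0 := by
      have := hB.mul_rpow_neg_one_mul_rpow (r := 1) one_ne_zero
      rw [hB.rpow_one', Matrix.mul_assoc, hcomm] at this
      rw [Matrix.mul_sub, Matrix.mul_one, this, sub_self]
    have h1 : A * (1 - B * B ^ (-1 : ℝ)) = 0 := by
      ext i j
      have hB0 : B *ᵥ (1 - B * B ^ (-1 : ℝ)).col j = 0 := by
        ext k
        exact congrFun₂ h0 k j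
      exact congrFun (h _ hB0) i
    rw [Matrix.mul_sub, Matrix.mul_one, sub_eq_zero] at h1
    exact h1.symm
  · intro h v hv
    rw [← h, ← hcomm, ← mulVec_mulVec, ← mulVec_mulVec, hv, mulVec_zero, mulVec_zero]

/-! ### Variational formula and joint convexity -/

theorem sandwichedOp_arg_posSemidef {A : Matrix n n ℂ} (hA : A.PosSemidef) (B : Matrix n n ℂ)
    (r : ℝ) : (B ^ r * A * B ^ r).PosSemidef := by
  have := hA.mul_mul_conjTranspose_same (B ^ r)
  rwa [rpow_isHermitian] at this

/-- The lower bound in the variational formula for the sandwiched quasi-relative entropy. -/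
theorem le_trace_sandwichedOp {α : ℝ} (hα : 1 < α) {A B : Matrix n n ℂ} (hA : A.PosSemidef)
    (hB : B.PosSemidef) (h : opSupport A ≤ opSupport B) (K : Matrix n n ℂ) :
    α * (A * (K * Kᴴ)).trace.re -
      (α - 1) * ((Kᴴ * B ^ ((α - 1) / α) * K) ^ (1 / ((α - 1) / α))).trace.re ≤
      (sandwichedOp α A B).trace.re := by
  have hα0 : 0 < α := by linarith
  have hα1 : 0 < α - 1 := by linarith
  rw [hB.opSupport_le_iff] at h
  set s : ℝ := (α - 1) / (2 * α) with hs
  have hs0 : s ≠ 0 := by positivity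
  have hneg : (1 - α) / (2 * α) = -s := by rw [hs]; ring
  have hDE : B ^ s * B ^ (-s) = B * B ^ (-1 : ℝ) := hB.rpow_mul_rpow_neg hs0
  have hED : B ^ (-s) * B ^ s = B * B ^ (-1 : ℝ) := by
    simpa using hB.rpow_mul_rpow_neg (neg_ne_zero.mpr hs0)
  have h' : B * B ^ (-1 : ℝ) * A = A := by
    have := congrArg conjTranspose h
    rw [← hDE, conjTranspose_mul, conjTranspose_mul, rpow_isHermitian, rpow_isHermitian,
      hA.isHermitian.eq, hED] at this
    exact this
  set C := B ^ (-s) * A * B ^ (-s) with hC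
  have hCpos : C.PosSemidef := sandwichedOp_arg_posSemidef hA B _
  -- Support inclusion enters here: without it, only the compression of A to the support of B is
  -- recovered.
  have hA' : B ^ s * C * B ^ s = A := by
    calc B ^ s * C * B ^ s = (B ^ s * B ^ (-s)) * A * (B ^ (-s) * B ^ s) := by
          rw [hC]; simp only [Matrix.mul_assoc]
      _ = A := by rw [hDE, hED, h', h]
  set M := B ^ s * K with hM
  have htr : (A * (K * Kᴴ)).trace = (C * (M * Mᴴ)).trace := by
    rw [← hA', hM, conjTranspose_mul, rpow_isHermitian, Matrix.mul_assoc (B ^ s),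
      Matrix.mul_assoc (B ^ s), trace_mul_comm (B ^ s)]
    simp only [Matrix.mul_assoc]
  have hMM : Mᴴ * M = Kᴴ * B ^ ((α - 1) / α) * K := by
    have hss : B ^ s * B ^ s = B ^ ((α - 1) / α) := by
      have : s + s = (α - 1) / α := by rw [hs]; field_simp; ring
      rw [hB.rpow_mul_rpow (Or.inl (by rw [this]; positivity)), this]
    rw [← hss, hM, conjTranspose_mul, rpow_isHermitian]
    simp only [Matrix.mul_assoc]
  -- Young for C and M Mᴴ with exponents α and α/(α - 1); then M Mᴴ is exchanged for Mᴴ M = Kᴴ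
  -- B^(2s) K.
  have hy := hCpos.trace_mul_le_young (posSemidef_self_mul_conjTranspose M) (p := 1 / α)
    (by positivity) (by rw [div_lt_one hα0]; exact hα)
  have he : 1 / (1 - 1 / α) = 1 / ((α - 1) / α) := by
    congr 1
    field_simp
  rw [he, one_div_one_div, trace_rpow_mul_conjTranspose_comm, hMM] at hy
  rw [sandwichedOp, hneg, htr]
  have := mul_le_mul_of_nonneg_left hy hα0.le
  have hexp : ∀ x y : ℝ, α * (1 / α * x + (1 - 1 / α) * y) = x + (α - 1) * y := fun x y => by
    field_simp
  rw [hexp] at this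
  linarith

/-- The bound `le_trace_sandwichedOp` is attained. -/
theorem exists_trace_sandwichedOp_eq {α : ℝ} (hα : 1 < α) {A B : Matrix n n ℂ}
    (hA : A.PosSemidef) (hB : B.PosSemidef) :
    ∃ K : Matrix n n ℂ, (sandwichedOp α A B).trace.re = α * (A * (K * Kᴴ)).trace.re -
      (α - 1) * ((Kᴴ * B ^ ((α - 1) / α) * K) ^ (1 / ((α - 1) / α))).trace.re := by
  have hα0 : 0 < α := by linarith
  have hα1 : 0 < α - 1 := by linarith
  set s : ℝ := (α - 1) / (2 * α) with hs
  have hs0 : s ≠ 0 := by positivity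
  have hneg : (1 - α) / (2 * α) = -s := by rw [hs]; ring
  have hDE : B ^ s * B ^ (-s) = B * B ^ (-1 : ℝ) := hB.rpow_mul_rpow_neg hs0
  have hED : B ^ (-s) * B ^ s = B * B ^ (-1 : ℝ) := by
    simpa using hB.rpow_mul_rpow_neg (neg_ne_zero.mpr hs0)
  have hss : B ^ s * B ^ s = B ^ ((α - 1) / α) := by
    have : s + s = (α - 1) / α := by rw [hs]; field_simp; ring
    rw [hB.rpow_mul_rpow (Or.inl (by rw [this]; positivity)), this]
  rw [sandwichedOp, hneg]
  set C := B ^ (-s) * A * B ^ (-s) with hC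
  have hCpos : C.PosSemidef := sandwichedOp_arg_posSemidef hA B _
  -- Equality in Young asks for M Mᴴ = C^(α-1), so M = C^β, and K = B^(-s) C^β is the maximizer.
  set β : ℝ := (α - 1) / 2 with hβ
  have hβ0 : 0 < β := by positivity
  have hββ : C ^ β * C ^ β = C ^ (α - 1) := by
    have : β + β = α - 1 := by rw [hβ]; ring
    rw [hCpos.rpow_mul_rpow (Or.inl (by rw [this]; positivity)), this]
  -- The leftmost factor of C is a power of B, so the support projection acts trivially.
  have hPC : B * B ^ (-1 : ℝ) * C ^ β = C ^ β := by
    have h1 : C ^ β = C * C ^ (β - 1) := by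
      rw [hCpos.self_mul_rpow (by rw [add_sub_cancel]; exact hβ0.ne'), add_sub_cancel]
    rw [h1, ← Matrix.mul_assoc]
    congr 1
    rw [hC, Matrix.mul_assoc (B ^ (-s)), ← Matrix.mul_assoc _ (B ^ (-s)),
      hB.mul_rpow_neg_one_mul_rpow (neg_ne_zero.mpr hs0)]
  have h1 : (A * (B ^ (-s) * C ^ β * (B ^ (-s) * C ^ β)ᴴ)).trace = (C ^ α).trace := by
    rw [conjTranspose_mul, rpow_isHermitian, rpow_isHermitian]
    calc (A * (B ^ (-s) * C ^ β * (C ^ β * B ^ (-s)))).trace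
        = ((A * B ^ (-s) * (C ^ β * C ^ β)) * B ^ (-s)).trace := by simp only [Matrix.mul_assoc]
      _ = (C * C ^ (α - 1)).trace := by
        rw [trace_mul_comm, hββ, hC]
        simp only [Matrix.mul_assoc]
      _ = (C ^ α).trace := by
        rw [hCpos.self_mul_rpow (by rw [add_sub_cancel]; exact hα0.ne'), add_sub_cancel]
  have h2 : (B ^ (-s) * C ^ β)ᴴ * B ^ ((α - 1) / α) * (B ^ (-s) * C ^ β) = C ^ (α - 1) := by
    rw [conjTranspose_mul, rpow_isHermitian, rpow_isHermitian, ← hss]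
    calc C ^ β * B ^ (-s) * (B ^ s * B ^ s) * (B ^ (-s) * C ^ β)
        = C ^ β * ((B ^ (-s) * B ^ s) * ((B ^ s * B ^ (-s)) * C ^ β)) := by
          simp only [Matrix.mul_assoc]
      _ = C ^ (α - 1) := by rw [hDE, hED, hPC, hPC, hββ]
  refine ⟨B ^ (-s) * C ^ β, ?_⟩
  have h3 : (α - 1) * (1 / ((α - 1) / α)) = α := by field_simp
  rw [h1, h2, hCpos.rpow_rpow, h3]
  ring

/-- Joint convexity of the trace functional defining the sandwiched quasi-relative entropy. -/
theorem trace_sandwichedOp_sum_le {ι : Type*} [Fintype ι] {α : ℝ} (hα : 1 < α) {w : ι → ℝ}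
    (hw : ∀ x, 0 ≤ w x) {A B : ι → Matrix n n ℂ} (hA : ∀ x, (A x).PosSemidef)
    (hB : ∀ x, (B x).PosSemidef) (h : ∀ x, w x ≠ 0 → opSupport (A x) ≤ opSupport (B x)) :
    (sandwichedOp α (∑ x, w x • A x) (∑ x, w x • B x)).trace.re ≤
      ∑ x, w x * (sandwichedOp α (A x) (B x)).trace.re := by
  have hα0 : 0 < α := by linarith
  have hα1 : 0 < α - 1 := by linarith
  have hA₀ : (∑ x, w x • A x).PosSemidef := posSemidef_sum _ fun x _ => (hA x).smul (hw x)
  have hB₀ : (∑ x, w x • B x).PosSemidef := posSemidef_sum _ fun x _ => (hB x).smul (hw x)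
  -- The maximizer for the averaged pair serves as a competitor for every pair.
  obtain ⟨K, hK⟩ := exists_trace_sandwichedOp_eq hα hA₀ hB₀
  have hT := sum_trace_conj_rpow_le hw hB K (p := (α - 1) / α) (by positivity)
    (by rw [div_lt_one hα0]; linarith)
  have hL : ((∑ x, w x • A x) * (K * Kᴴ)).trace.re = ∑ x, w x * (A x * (K * Kᴴ)).trace.re := by
    simp [Matrix.sum_mul, trace_sum, Complex.re_sum]
  rw [hK, hL]
  have hx : ∀ x, w x * (α * (A x * (K * Kᴴ)).trace.re - (α - 1) *
      ((Kᴴ * B x ^ ((α - 1) / α) * K) ^ (1 / ((α - 1) / α))).trace.re) ≤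
      w x * (sandwichedOp α (A x) (B x)).trace.re := fun x => by
    rcases eq_or_ne (w x) 0 with h0 | h0
    · simp [h0]
    · exact mul_le_mul_of_nonneg_left
        (le_trace_sandwichedOp hα (hA x) (hB x) (h x h0) K) (hw x)
  have hsum := Finset.sum_le_sum fun x (_ : x ∈ Finset.univ) => hx x
  simp only [mul_sub, Finset.sum_sub_distrib, mul_left_comm (w _)] at hsum
  rw [← Finset.mul_sum, ← Finset.mul_sum] at hsum
  have := mul_le_mul_of_nonneg_left hT hα1.le
  linarith

/-- On the kernel of the averaged B, nonnegative quadratic forms sum to zero, so each B of nonzero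
weight vanishes there. -/
theorem opSupport_sum_le {ι : Type*} [Fintype ι] {w : ι → ℝ} (hw : ∀ x, 0 ≤ w x)
    {A B : ι → Matrix n n ℂ} (hB : ∀ x, (B x).PosSemidef)
    (h : ∀ x, w x ≠ 0 → opSupport (A x) ≤ opSupport (B x)) :
    opSupport (∑ x, w x • A x) ≤ opSupport (∑ x, w x • B x) := by
  rw [opSupport_le_iff_mulVec]
  intro v hv
  have hterm : ∀ x, 0 ≤ star v ⬝ᵥ ((w x • B x) *ᵥ v) := fun x =>
    ((hB x).smul (hw x)).dotProduct_mulVec_nonneg v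
  have hsum : ∑ x, star v ⬝ᵥ ((w x • B x) *ᵥ v) = 0 := by
    rw [← dotProduct_sum, ← sum_mulVec, hv, dotProduct_zero]
  rw [Finset.sum_eq_zero_iff_of_nonneg fun x _ => hterm x] at hsum
  rw [sum_mulVec]
  refine Finset.sum_eq_zero fun x hx => ?_
  rcases eq_or_ne (w x) 0 with h0 | h0
  · simp [h0]
  · have h1 := (((hB x).smul (hw x)).dotProduct_mulVec_zero_iff v).mp (hsum x hx)
    rw [smul_mulVec, smul_eq_zero, or_iff_right h0] at h1
    rw [smul_mulVec, opSupport_le_iff_mulVec.mp (h x h0) v h1, smul_zero]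

/-! ### Extended-valued convexity and unitary invariance -/

theorem sandwichedQ_of_le {α : ℝ} {A B : Matrix n n ℂ} (h : opSupport A ≤ opSupport B) :
    sandwichedQ α A B = ENNReal.ofReal (sandwichedOp α A B).trace.re := if_pos h

theorem sandwichedQ_of_not_le {α : ℝ} {A B : Matrix n n ℂ} (h : ¬ opSupport A ≤ opSupport B) :
    sandwichedQ α A B = ∞ := if_neg h

theorem sandwichedQ_sum_le {ι : Type*} [Fintype ι] {α : ℝ} (hα : 1 < α) {w : ι → ℝ}
    (hw : ∀ x, 0 ≤ w x) {A B : ι → Matrix n n ℂ} (hA : ∀ x, (A x).PosSemidef)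
    (hB : ∀ x, (B x).PosSemidef) :
    sandwichedQ α (∑ x, w x • A x) (∑ x, w x • B x) ≤
      ∑ x, ENNReal.ofReal (w x) * sandwichedQ α (A x) (B x) := by
  by_cases h : ∀ x, w x ≠ 0 → opSupport (A x) ≤ opSupport (B x)
  · rw [sandwichedQ_of_le (opSupport_sum_le hw hB h)]
    have hterm : ∀ x, ENNReal.ofReal (w x) * sandwichedQ α (A x) (B x) =
        ENNReal.ofReal (w x * (sandwichedOp α (A x) (B x)).trace.re) := fun x => by
      rcases eq_or_ne (w x) 0 with h0 | h0
      · simp [h0]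
      · rw [sandwichedQ_of_le (h x h0), ENNReal.ofReal_mul (hw x)]
    simp only [hterm]
    rw [← ENNReal.ofReal_sum_of_nonneg fun x _ => mul_nonneg (hw x)
      (Complex.le_def.mp (sandwichedOp_trace_nonneg α (A x) (B x))).1]
    exact ENNReal.ofReal_le_ofReal (trace_sandwichedOp_sum_le hα hw hA hB h)
  · push Not at h
    obtain ⟨x, h0, hx⟩ := h
    refine le_top.trans_eq (Eq.symm ?_)
    rw [ENNReal.sum_eq_top]
    refine ⟨x, Finset.mem_univ x, ?_⟩
    rw [sandwichedQ_of_not_le hx]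
    exact ENNReal.mul_top (ENNReal.ofReal_pos.mpr ((hw x).lt_of_ne' h0)).ne'

theorem sandwichedQ_unitary_conj (α : ℝ) {A B U : Matrix n n ℂ} (hA : A.PosSemidef)
    (hB : B.PosSemidef) (hU : U ∈ unitaryGroup n ℂ) :
    sandwichedQ α (U * A * Uᴴ) (U * B * Uᴴ) = sandwichedQ α A B := by
  have hUU := conjTranspose_mul_self_of_mem_unitaryGroup hU
  have hmul : ∀ X Y : Matrix n n ℂ, U * X * Uᴴ * (U * Y * Uᴴ) = U * (X * Y) * Uᴴ := fun X Y => by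
    calc U * X * Uᴴ * (U * Y * Uᴴ) = U * X * (Uᴴ * U) * Y * Uᴴ := by
          simp only [Matrix.mul_assoc]
      _ = _ := by rw [hUU, Matrix.mul_one]; simp only [Matrix.mul_assoc]
  have hinj : ∀ X Y : Matrix n n ℂ, U * X * Uᴴ = U * Y * Uᴴ ↔ X = Y := fun X Y => by
    refine ⟨fun h => ?_, fun h => by rw [h]⟩
    have hX : ∀ X : Matrix n n ℂ, Uᴴ * (U * X * Uᴴ) * U = X := fun X => by
      calc Uᴴ * (U * X * Uᴴ) * U = (Uᴴ * U) * X * (Uᴴ * U) := by simp only [Matrix.mul_assoc]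
        _ = X := by rw [hUU, Matrix.one_mul, Matrix.mul_one]
    rw [← hX X, h, hX]
  have hsupp : opSupport (U * A * Uᴴ) ≤ opSupport (U * B * Uᴴ) ↔ opSupport A ≤ opSupport B := by
    rw [hB.opSupport_le_iff, (hB.mul_mul_conjTranspose_same U).opSupport_le_iff,
      hB.conj_rpow hU, hmul, hmul, hinj]
  have hop : (sandwichedOp α (U * A * Uᴴ) (U * B * Uᴴ)).trace = (sandwichedOp α A B).trace := by
    rw [sandwichedOp, sandwichedOp, hB.conj_rpow hU, hmul, hmul,
      (sandwichedOp_arg_posSemidef hA B _).conj_rpow hU, trace_mul_comm, ← Matrix.mul_assoc, hUU,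
      Matrix.one_mul]
  by_cases h : opSupport A ≤ opSupport B
  · rw [sandwichedQ_of_le h, sandwichedQ_of_le (hsupp.mpr h), hop]
  · rw [sandwichedQ_of_not_le h, sandwichedQ_of_not_le (mt hsupp.mp h)]

/-! ### Tensor products -/

theorem sandwichedOp_kronecker (α : ℝ) {A₁ B₁ : Matrix n n ℂ} {A₂ B₂ : Matrix m m ℂ}
    (hA₁ : A₁.PosSemidef) (hB₁ : B₁.PosSemidef) (hA₂ : A₂.PosSemidef) (hB₂ : B₂.PosSemidef) :
    sandwichedOp α (A₁ ⊗ₖ A₂) (B₁ ⊗ₖ B₂) = sandwichedOp α A₁ B₁ ⊗ₖ sandwichedOp α A₂ B₂ := by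
  simp only [sandwichedOp]
  rw [hB₁.kronecker_rpow hB₂, ← mul_kronecker_mul, ← mul_kronecker_mul,
    (sandwichedOp_arg_posSemidef hA₁ B₁ _).kronecker_rpow (sandwichedOp_arg_posSemidef hA₂ B₂ _)]

theorem opSupport_kronecker_le {A₁ B₁ : Matrix n n ℂ} {A₂ B₂ : Matrix m m ℂ}
    (hB₁ : B₁.PosSemidef) (hB₂ : B₂.PosSemidef) (h₁ : opSupport A₁ ≤ opSupport B₁)
    (h₂ : opSupport A₂ ≤ opSupport B₂) :
    opSupport (A₁ ⊗ₖ A₂) ≤ opSupport (B₁ ⊗ₖ B₂) := by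
  rw [(hB₁.kronecker hB₂).opSupport_le_iff, hB₁.kronecker_rpow hB₂, ← mul_kronecker_mul,
    ← mul_kronecker_mul, hB₁.opSupport_le_iff.mp h₁, hB₂.opSupport_le_iff.mp h₂]

/-- Test on product vectors v ⊗ u with A₂ u ≠ 0: the nonzero factor can be cancelled. -/
theorem opSupport_le_of_kronecker_left {A₁ B₁ : Matrix n n ℂ} {A₂ B₂ : Matrix m m ℂ}
    (hA₂ : A₂ ≠ 0) (h : opSupport (A₁ ⊗ₖ A₂) ≤ opSupport (B₁ ⊗ₖ B₂)) :
    opSupport A₁ ≤ opSupport B₁ := by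
  rw [opSupport_le_iff_mulVec] at h ⊢
  intro v hv
  obtain ⟨u, j, hu⟩ := exists_mulVec_apply_ne_zero hA₂
  have := h (fun k => v k.1 * u k.2) (by ext ⟨i, j⟩; rw [kronecker_mulVec_mul, hv]; simp)
  ext i
  have hij := congrFun this (i, j)
  rw [kronecker_mulVec_mul] at hij
  exact (mul_eq_zero.mp hij).resolve_right hu

theorem opSupport_le_of_kronecker_right {A₁ B₁ : Matrix n n ℂ} {A₂ B₂ : Matrix m m ℂ}
    (hA₁ : A₁ ≠ 0) (h : opSupport (A₁ ⊗ₖ A₂) ≤ opSupport (B₁ ⊗ₖ B₂)) :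
    opSupport A₂ ≤ opSupport B₂ := by
  rw [opSupport_le_iff_mulVec] at h ⊢
  intro u hu
  obtain ⟨v, i, hv⟩ := exists_mulVec_apply_ne_zero hA₁
  have := h (fun k => v k.1 * u k.2) (by ext ⟨i, j⟩; rw [kronecker_mulVec_mul, hu]; simp)
  ext j
  have hij := congrFun this (i, j)
  rw [kronecker_mulVec_mul] at hij
  exact (mul_eq_zero.mp hij).resolve_left hv

theorem opSupport_zero_le (B : Matrix n n ℂ) : opSupport (0 : Matrix n n ℂ) ≤ opSupport B :=
  opSupport_le_iff_mulVec.mpr fun v _ => zero_mulVec v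

theorem sandwichedQ_zero_left {α : ℝ} (hα : α ≠ 0) (B : Matrix n n ℂ) :
    sandwichedQ α 0 B = 0 := by
  have h : (0 : Matrix n n ℂ) ^ α = 0 := CFC.zero_rpow hα
  rw [sandwichedQ_of_le (opSupport_zero_le B), sandwichedOp, Matrix.mul_zero, Matrix.zero_mul, h]
  simp

/-- Zero trace forces the sandwiched matrix to vanish, and support inclusion lets the powers of B be
undone. It ensures that an infinite factor in the product rule is never multiplied by 0 when both
first arguments are nonzero. -/
theorem sandwichedQ_eq_zero_iff {α : ℝ} (hα : 1 < α) {A B : Matrix n n ℂ} (hA : A.PosSemidef)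
    (hB : B.PosSemidef) : sandwichedQ α A B = 0 ↔ A = 0 := by
  have hα0 : 0 < α := by linarith
  refine ⟨fun h => ?_, fun h => h ▸ sandwichedQ_zero_left hα0.ne' B⟩
  by_cases hs : opSupport A ≤ opSupport B
  · rw [sandwichedQ_of_le hs, ENNReal.ofReal_eq_zero] at h
    have h0 := Complex.le_def.mp (sandwichedOp_trace_nonneg α A B)
    have htr : (sandwichedOp α A B).trace = 0 := Complex.ext (le_antisymm h h0.1) h0.2.symm
    have hC := (sandwichedOp_arg_posSemidef hA B _).eq_zero_of_trace_rpow_eq_zero hα0.ne' htr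
    set r : ℝ := (1 - α) / (2 * α) with hr
    have hr0 : r ≠ 0 := div_ne_zero (by linarith) (by linarith)
    rw [hB.opSupport_le_iff, ← hB.rpow_mul_rpow_neg hr0] at hs
    have h1 : B ^ r * A = 0 := by
      rw [← hs, ← Matrix.mul_assoc, ← Matrix.mul_assoc, hC, Matrix.zero_mul]
    have h2 : A * B ^ r = 0 := by
      have := congrArg conjTranspose h1
      rwa [conjTranspose_mul, rpow_isHermitian, hA.isHermitian.eq, conjTranspose_zero] at this
    rw [← hs, ← Matrix.mul_assoc, h2, Matrix.zero_mul]
  · rw [sandwichedQ_of_not_le hs] at h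
    exact absurd h ENNReal.top_ne_zero

theorem sandwichedQ_kronecker {α : ℝ} (hα : 1 < α) {A₁ B₁ : Matrix n n ℂ}
    {A₂ B₂ : Matrix m m ℂ} (hA₁ : A₁.PosSemidef) (hB₁ : B₁.PosSemidef) (hA₂ : A₂.PosSemidef)
    (hB₂ : B₂.PosSemidef) :
    sandwichedQ α (A₁ ⊗ₖ A₂) (B₁ ⊗ₖ B₂) = sandwichedQ α A₁ B₁ * sandwichedQ α A₂ B₂ := by
  have hα0 : α ≠ 0 := by linarith
  rcases eq_or_ne A₁ 0 with rfl | h₁0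
  · rw [zero_kronecker, sandwichedQ_zero_left hα0, sandwichedQ_zero_left hα0, zero_mul]
  rcases eq_or_ne A₂ 0 with rfl | h₂0
  · rw [kronecker_zero, sandwichedQ_zero_left hα0, sandwichedQ_zero_left hα0, mul_zero]
  by_cases h₁ : opSupport A₁ ≤ opSupport B₁
  · by_cases h₂ : opSupport A₂ ≤ opSupport B₂
    · have hn₁ := Complex.le_def.mp (sandwichedOp_trace_nonneg α A₁ B₁)
      have hn₂ := Complex.le_def.mp (sandwichedOp_trace_nonneg α A₂ B₂)
      rw [sandwichedQ_of_le h₁, sandwichedQ_of_le h₂,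
        sandwichedQ_of_le (opSupport_kronecker_le hB₁ hB₂ h₁ h₂),
        sandwichedOp_kronecker α hA₁ hB₁ hA₂ hB₂, trace_kronecker, ← ENNReal.ofReal_mul hn₁.1,
        Complex.mul_re, ← hn₁.2, Complex.zero_im, zero_mul, sub_zero]
    · rw [sandwichedQ_of_not_le h₂,
        sandwichedQ_of_not_le fun h => h₂ (opSupport_le_of_kronecker_right h₁0 h),
        ENNReal.mul_top fun h => h₁0 ((sandwichedQ_eq_zero_iff hα hA₁ hB₁).mp h)]
  · rw [sandwichedQ_of_not_le h₁,
      sandwichedQ_of_not_le fun h => h₁ (opSupport_le_of_kronecker_left h₂0 h),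
      ENNReal.top_mul fun h => h₂0 ((sandwichedQ_eq_zero_iff hα hA₂ hB₂).mp h)]

/-- The exponents inside the outer power add up to 1/α, which that power cancels. -/
theorem sandwichedQ_self {α : ℝ} (hα : 1 < α) {A : Matrix n n ℂ} (hA : A.PosSemidef) :
    sandwichedQ α A A = ENNReal.ofReal A.trace.re := by
  have hα0 : 0 < α := by linarith
  have hop : sandwichedOp α A A = A := by
    have h1 : 1 + (1 - α) / (2 * α) = (α + 1) / (2 * α) := by field_simp; ring
    have h2 : (1 - α) / (2 * α) + (α + 1) / (2 * α) = 1 / α := by field_simp; ring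
    rw [sandwichedOp, Matrix.mul_assoc, hA.self_mul_rpow (by rw [h1]; positivity), h1,
      hA.rpow_mul_rpow (Or.inl (by rw [h2]; positivity)), h2, hA.rpow_rpow,
      one_div_mul_cancel hα0.ne', hA.rpow_one']
  rw [sandwichedQ_of_le le_rfl, hop]

end Sandwiched

end Matrix

theorem mainTheorem4 {n m ι : Type*} [Fintype n] [DecidableEq n] [Fintype m] [DecidableEq m]
    [Fintype ι] (α : ℝ) (hα : 1 < α) :
    -- invariance under unitary conjugation
    (∀ A B U : Matrix n n ℂ, A.PosSemidef → B.PosSemidef → U ∈ Matrix.unitaryGroup n ℂ →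
      sandwichedQ α (U * A * Uᴴ) (U * B * Uᴴ) = sandwichedQ α A B) ∧
    -- multiplicativity under tensor products
    (∀ (A₁ B₁ : Matrix n n ℂ) (A₂ B₂ : Matrix m m ℂ),
      A₁.PosSemidef → B₁.PosSemidef → A₂.PosSemidef → B₂.PosSemidef →
      sandwichedQ α (A₁ ⊗ₖ A₂) (B₁ ⊗ₖ B₂) = sandwichedQ α A₁ B₁ * sandwichedQ α A₂ B₂) ∧
    -- invariance under tensoring with a state
    (∀ (A B : Matrix n n ℂ) (τ : Matrix m m ℂ),
      A.PosSemidef → B.PosSemidef → τ.PosSemidef → τ.trace = 1 →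
      sandwichedQ α (A ⊗ₖ τ) (B ⊗ₖ τ) = sandwichedQ α A B) ∧
    -- joint convexity
    (α ≤ 2 → ∀ (p : ι → ℝ) (A B : ι → Matrix n n ℂ),
      (∀ x, 0 ≤ p x) → ∑ x, p x = 1 →
      (∀ x, (A x).PosSemidef) → (∀ x, (B x).PosSemidef) →
      sandwichedQ α (∑ x, p x • A x) (∑ x, p x • B x) ≤
        ∑ x, ENNReal.ofReal (p x) * sandwichedQ α (A x) (B x)) :=
  ⟨fun _ _ _ hA hB hU => Matrix.sandwichedQ_unitary_conj α hA hB hU,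
    fun _ _ _ _ hA₁ hB₁ hA₂ hB₂ => Matrix.sandwichedQ_kronecker hα hA₁ hB₁ hA₂ hB₂,
    fun A B τ hA hB hτ htr => by
      rw [Matrix.sandwichedQ_kronecker hα hA hB hτ hτ, Matrix.sandwichedQ_self hα hτ, htr]
      simp,
    fun _ _ _ _ hp _ hA hB => Matrix.sandwichedQ_sum_le hα hp hA hB⟩
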